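/- Let $L$ be a field. An $L$-bimodule is an abelian group $P$ with a left and a right action of $L$ that commute with each other (the two actions need not coincide). The center of $P$ is $\mathcal Z(P)=\{z\in L : zx=xz \text{ for all } x\in P\}$, which is a subfield of $L$. For an integer $d\ge 1$, $P$ is called a Galois $L$-bimodule of rank $d$ if $P\cong L^d$ as a left $L$-module and as a right $L$-module, and $P\otimes_L P\cong P^d$ as $L$-bimodules. Theorem. Let $P$ be a Galois $L$-bimodule of rank $d$. Then there is an integer $r\ge 0$ such that $P\cong (L\otimes_{\mathcal Z(P)}L)^r$ as $L$-bimodules. In particular, $[L:\mathcal Z(P)]$ is finite and divides $d$. -/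

import Mathlib

open scoped TensorProduct

/-! An `A`-bimodule `P` (for a commutative ring `A`) is an abelian group with a left action
`[Module A P]`, a right action `[Module Aᵐᵒᵖ P]`, where `x a` is written `MulOpposite.op a • x`,
and `[SMulCommClass A Aᵐᵒᵖ P]`, i.e. `(a x) b = a (x b)`.  The two actions are unrelated. -/

/-- An isomorphism of bimodules: an additive bijection respecting both actions. -/
structure BimodEquiv (A M N : Type*) [CommRing A] [AddCommGroup M] [AddCommGroup N]
    [Module A M] [Module Aᵐᵒᵖ M] [Module A N] [Module Aᵐᵒᵖ N] extends M ≃+ N where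
  map_left : ∀ (a : A) (x : M), toFun (a • x) = a • toFun x
  map_right : ∀ (a : A) (x : M), toFun (MulOpposite.op a • x) = MulOpposite.op a • toFun x

/-- The abelian group `P`, whose `A`-module structure is the *right* action of the commutative
ring `A` on the bimodule `P`. -/
def RightAct (A P : Type*) [CommRing A] [AddCommGroup P] [Module Aᵐᵒᵖ P] : Type _ :=
  P

namespace RightAct

variable (A P : Type*) [CommRing A] [AddCommGroup P] [Module A P] [Module Aᵐᵒᵖ P]
  [SMulCommClass A Aᵐᵒᵖ P]

instance : AddCommGroup (RightAct A P) :=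
  inferInstanceAs (AddCommGroup P)

instance : Module A (RightAct A P) :=
  Module.compHom P (RingEquiv.toOpposite A).toRingHom

/-- The identity map `P → RightAct A P`. -/
def of (x : P) : RightAct A P :=
  x

/-- The left action of `A` on `P`, as endomorphisms of the right module `P`. -/
def leftEnd : A →+* Module.End A (RightAct A P) where
  toFun a :=
    { toFun := fun x => (a • (show P from x) : P)
      map_add' := fun x y => smul_add a (show P from x) (show P from y)
      map_smul' := fun b x => smul_comm a (MulOpposite.op b) (show P from x) }
  map_one' := LinearMap.ext fun x => one_smul A (show P from x)
  map_mul' a b := LinearMap.ext fun x => mul_smul a b (show P from x)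
  map_zero' := LinearMap.ext fun x => zero_smul A (show P from x)
  map_add' a b := LinearMap.ext fun x => add_smul a b (show P from x)

end RightAct

/-- The tensor product `P ⊗_A Q` of two bimodules over a commutative ring `A`, in which
`(x a) ⊗ y = x ⊗ (a y)`.  Its bimodule structure is `a (x ⊗ y) b = (a x) ⊗ (y b)`. -/
def BimodTensor (A P Q : Type*) [CommRing A] [AddCommGroup P] [AddCommGroup Q]
    [Module Aᵐᵒᵖ P] [Module A Q] : Type _ :=
  RightAct A P ⊗[A] Q

namespace BimodTensor

variable (A : Type*) {P Q : Type*} [CommRing A] [AddCommGroup P] [AddCommGroup Q]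
  [Module A P] [Module Aᵐᵒᵖ P] [SMulCommClass A Aᵐᵒᵖ P]
  [Module A Q] [Module Aᵐᵒᵖ Q] [SMulCommClass A Aᵐᵒᵖ Q]

noncomputable instance : AddCommGroup (BimodTensor A P Q) :=
  inferInstanceAs (AddCommGroup (RightAct A P ⊗[A] Q))

/-- The left action, on the first factor. -/
noncomputable instance : Module A (BimodTensor A P Q) :=
  Module.compHom (RightAct A P ⊗[A] Q)
    ((Module.End.rTensorAlgHom A (RightAct A P) Q).toRingHom.comp (RightAct.leftEnd A P))

/-- The right action, on the second factor. -/
noncomputable instance : Module Aᵐᵒᵖ (BimodTensor A P Q) :=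
  haveI : SMulCommClass Aᵐᵒᵖ A Q := SMulCommClass.symm A Aᵐᵒᵖ Q
  Module.compHom (RightAct A P ⊗[A] Q)
    ((Module.End.lTensorAlgHom A Q (RightAct A P)).toRingHom.comp
      (Module.toModuleEnd A (S := Aᵐᵒᵖ) Q))

/-- The pure tensor `x ⊗ y`. -/
noncomputable def tmul {P Q : Type*} [AddCommGroup P] [AddCommGroup Q] [Module Aᵐᵒᵖ P]
    [Module A Q] (x : P) (y : Q) : BimodTensor A P Q :=
  RightAct.of A P x ⊗ₜ[A] y

theorem left_smul_tmul {A P Q : Type*} [CommRing A] [AddCommGroup P] [AddCommGroup Q]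
    [Module A P] [Module Aᵐᵒᵖ P] [SMulCommClass A Aᵐᵒᵖ P] [Module A Q] (a : A) (x : P) (y : Q) :
    a • tmul A x y = tmul A (a • x) y :=
  rfl

theorem right_smul_tmul {A P Q : Type*} [CommRing A] [AddCommGroup P] [AddCommGroup Q]
    [Module Aᵐᵒᵖ P] [Module A Q] [Module Aᵐᵒᵖ Q] [SMulCommClass A Aᵐᵒᵖ Q]
    (a : A) (x : P) (y : Q) :
    MulOpposite.op a • tmul A x y = tmul A x (MulOpposite.op a • y) :=
  rfl

instance : SMulCommClass A Aᵐᵒᵖ (BimodTensor A P Q) where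
  smul_comm a b t :=
    haveI : SMulCommClass Aᵐᵒᵖ A Q := SMulCommClass.symm A Aᵐᵒᵖ Q
    LinearMap.congr_fun
      ((LinearMap.rTensor_comp_lTensor _ (RightAct.leftEnd A P a) (Module.toModuleEnd A Q b)).trans
        (LinearMap.lTensor_comp_rTensor _ (RightAct.leftEnd A P a)
          (Module.toModuleEnd A Q b)).symm) t

theorem op_smul_tmul {A P Q : Type*} [CommRing A] [AddCommGroup P] [AddCommGroup Q]
    [Module Aᵐᵒᵖ P] [Module A Q] (a : A) (x : P) (y : Q) :
    tmul A (MulOpposite.op a • x) y = tmul A x (a • y) :=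
  TensorProduct.smul_tmul a (RightAct.of A P x) y

end BimodTensor

/-- `P` is a Galois `A`-bimodule of rank `d`: `d ≥ 1`, `P ≅ A^d` as a left module and as a right
module, and `P ⊗_A P ≅ P^d` as bimodules. -/
structure IsGaloisBimodule (A P : Type*) [CommRing A] [AddCommGroup P] [Module A P]
    [Module Aᵐᵒᵖ P] [SMulCommClass A Aᵐᵒᵖ P] (d : ℕ) : Prop where
  one_le : 1 ≤ d
  free_left : Nonempty (P ≃ₗ[A] (Fin d → A))
  free_right : Nonempty (P ≃ₗ[Aᵐᵒᵖ] (Fin d → A))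
  tensor_self : Nonempty (BimodEquiv A (BimodTensor A P P) (Fin d → P))

/-- The center of a bimodule `P` over a field `L`: all `z` in `L` with `z x = x z` for all `x`
in `P`.  It is a subfield of `L`. -/
def bimodCenter (L P : Type*) [Field L] [AddCommGroup P] [Module L P] [Module Lᵐᵒᵖ P]
    [SMulCommClass L Lᵐᵒᵖ P] : Subfield L where
  carrier := {z | ∀ x : P, z • x = MulOpposite.op z • x}
  mul_mem' {z w} hz hw x := by
    rw [mul_smul, hw x, smul_comm, hz x, ← mul_smul, ← MulOpposite.op_mul]
  one_mem' x := by simp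
  add_mem' {z w} hz hw x := by
    rw [add_smul, hz x, hw x, ← add_smul, ← MulOpposite.op_add]
  zero_mem' x := by simp
  neg_mem' {z} hz x := by
    rw [neg_smul, hz x, ← neg_smul, ← MulOpposite.op_neg]
  inv_mem' z hz x := by
    by_cases h : z = 0
    · simp [h]
    · have h1 : x = z • MulOpposite.op z⁻¹ • x := by
        rw [hz, ← mul_smul, ← MulOpposite.op_mul, inv_mul_cancel₀ h, MulOpposite.op_one, one_smul]
      calc z⁻¹ • x = z⁻¹ • z • MulOpposite.op z⁻¹ • x := by rw [← h1]
        _ = MulOpposite.op z⁻¹ • x := by rw [← mul_smul, inv_mul_cancel₀ h, one_smul]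

/-- The `L`-bimodule `L ⊗_F L`, for a subfield `F` of a field `L`, in which
`a (x ⊗ y) b = (a x) ⊗ (y b)`. -/
def SelfTensor {L : Type*} [Field L] (F : Subfield L) : Type _ :=
  L ⊗[F] L

namespace SelfTensor

variable {L : Type*} [Field L] (F : Subfield L)

noncomputable instance : AddCommGroup (SelfTensor F) :=
  inferInstanceAs (AddCommGroup (L ⊗[F] L))

/-- The left action, `a t = (a ⊗ 1) * t`. -/
noncomputable instance : Module L (SelfTensor F) :=
  Module.compHom (L ⊗[F] L)
    (Algebra.TensorProduct.includeLeft : L →ₐ[F] L ⊗[F] L).toRingHom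

/-- The right action, `t b = (1 ⊗ b) * t`. -/
noncomputable instance : Module Lᵐᵒᵖ (SelfTensor F) :=
  Module.compHom (L ⊗[F] L)
    ((Algebra.TensorProduct.includeRight : L →ₐ[F] L ⊗[F] L).toRingHom.comp
      (RingEquiv.toOpposite L).symm.toRingHom)

instance : SMulCommClass L Lᵐᵒᵖ (SelfTensor F) where
  smul_comm a b t :=
    mul_left_comm (a ⊗ₜ[F] (1 : L)) ((1 : L) ⊗ₜ[F] b.unop) (show L ⊗[F] L from t)

/-- The pure tensor `x ⊗ y`. -/
noncomputable def tmul (x y : L) : SelfTensor F :=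
  x ⊗ₜ[F] y

theorem left_smul_tmul (a x y : L) : a • tmul F x y = tmul F (a * x) y := by
  change (a ⊗ₜ[F] (1 : L)) * (x ⊗ₜ[F] y) = (a * x) ⊗ₜ[F] y
  rw [Algebra.TensorProduct.tmul_mul_tmul, one_mul]

theorem right_smul_tmul (a x y : L) :
    MulOpposite.op a • tmul F x y = tmul F x (y * a) := by
  change ((1 : L) ⊗ₜ[F] a) * (x ⊗ₜ[F] y) = x ⊗ₜ[F] (y * a)
  rw [Algebra.TensorProduct.tmul_mul_tmul, one_mul, mul_comm]

end SelfTensor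

/-!
Write `F` for the center of the Galois bimodule `P`, and `S = L ⊗[F] L`.

*The center is large.* Pick a left basis `e` of `P` and write `e i * b = ∑ j, ψ b i j * e j`. The
left `L`-span `E` of the functions `b ↦ ψ b i j` consists of all matrix coefficients
`b ↦ φ (p * b)`, `φ` a left linear form (`apply_op_smul_mem`). The composite of two matrix
coefficients of `P` is one of `P ⊗ P ≅ P ^ d`, hence again lies in `E` (`comp_mem_coeffSpan`). So
`E` is a finite-dimensional algebra, a priori without unit, of additive maps `L → L`, stable under
multiplications by `L` on both sides. The argument of the Jacobson–Bourbaki theorem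
(`exists_basis_coord_mem`) then shows that `L` is finite over `F`, of dimension `n` say, and that
the coordinate functions of some `F`-basis of `L` lie in `E`; that is, `E = End_F L`.

*`P` has few quotients.* Fix a field `κ` and `τ : L → κ`. For a finite-dimensional `κ`-space `Z` with
an action `θ` of `L`, let `Hom(P, Z)` be the space of maps that are left linear through `θ` and right
linear through `τ`. The space `W = Hom_left (P ^ d, Z)` carries the action of `L` that comes from the
right action on `P ^ d`, and `Hom(P, W) ≅ Hom(P ^ d ⊗ P, Z)` has dimension `d ^ 2 * dim Hom(P, Z)`,
because `P ⊗ P ≅ P ^ d` (`le_finrank_bimodHoms_coind`). On the other hand `S` embeds in `P ^ d` by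
`1 ⊗ 1 ↦ (e 1, …, e d)`, since `E` is all of `End_F L`. The forms in `W` that vanish on `S` make up a
stable subspace `K` of codimension `n * dim Z` (`finrank_ker_diagEval`), while
`Hom(P, W) / Hom(P, K)` embeds in `Hom(S ⊗ P, Z) = Hom_right (P, Z)`, of dimension `d * dim Z`
(`finrank_bimodHoms_coind_le`). If `c` is the least constant with `dim Hom(P, Z) ≤ c * dim Z` for
all `Z`, this gives `d ^ 2 * c ≤ c * (d ^ 2 - n) + d`, so `n * c ≤ d` (`mul_finrank_bimodHoms_le`).

*`P` is free over `S`.* With `Z = κ` a residue field of `S` at a maximal ideal `m`, the bound says that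
`P / m P` has dimension at most `r = ⌊d / n⌋`. As `S` is Artinian, Nakayama's lemma and the Chinese
remainder theorem yield `r` generators of `P` over `S` (`exists_fin_span_eq_top`). The surjection
`S ^ r → P` goes from a left space of dimension `n * r ≤ d` to one of dimension `d`, so it is an
isomorphism and `n * r = d`.
-/

open MulOpposite (op)

/-! ### Finite-dimensional spaces of functions and the Jacobson–Bourbaki argument -/

/-- A finite-dimensional space of functions has a basis dual to finitely many evaluations, because the
evaluations span its dual. -/
theorem exists_dual_points {K α : Type*} [Field K] (E : Submodule K (α → K))
    [FiniteDimensional K E] :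
    ∃ (n : ℕ) (x : Fin n → α) (f : Fin n → α → K), (∀ i, f i ∈ E) ∧
      (∀ i j, f i (x j) = if i = j then 1 else 0) ∧
      ∀ g ∈ E, g = ∑ i, g (x i) • f i := by
  let ev : α → Module.Dual K E := fun a => (LinearMap.proj a).comp E.subtype
  have hspan : Submodule.span K (Set.range ev) = ⊤ := by
    rw [← Subspace.dualCoannihilator_dualAnnihilator_eq (W := Submodule.span K (Set.range ev))]
    have : (Submodule.span K (Set.range ev)).dualCoannihilator = ⊥ := by
      rw [eq_bot_iff]
      intro g hg
      rw [Submodule.mem_dualCoannihilator] at hg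
      refine Subtype.ext (funext fun a => ?_)
      exact hg (ev a) (Submodule.subset_span ⟨a, rfl⟩)
    rw [this, Submodule.dualAnnihilator_bot]
  obtain ⟨s, hs, hspan', hli⟩ := exists_linearIndependent K (Set.range ev)
  have hfin : Finite s := hli.finite
  obtain ⟨n, ⟨φ⟩⟩ := Finite.exists_equiv_fin s
  let B0 : Module.Basis s K (Module.Dual K E) := Module.Basis.mk hli (by
    rw [Subtype.range_coe, hspan', hspan])
  let B := B0.reindex φ
  have hB : ∀ i, ∃ a, B i = ev a := fun i => by
    obtain ⟨a, ha⟩ := hs (φ.symm i).2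
    exact ⟨a, by simp [B, B0, ha]⟩
  choose x hx using hB
  let C := B.dualBasis.map (Module.evalEquiv K E).symm
  have hC : ∀ i j, ev (x j) (C i) = if i = j then 1 else 0 := by
    intro i j
    have : ev (x j) (C i) = (Module.evalEquiv K E (C i)) (ev (x j)) := rfl
    rw [this, ← hx]
    simp [C, Finsupp.single_apply, eq_comm]
  refine ⟨n, x, fun i => (C i : α → K), fun i => (C i).2, hC, fun g hg => ?_⟩
  have h : (⟨g, hg⟩ : E) = ∑ i, g (x i) • C i := by
    conv_lhs => rw [← C.sum_repr ⟨g, hg⟩]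
    refine Finset.sum_congr rfl fun i _ => ?_
    congr 1
    have h2 := congrArg (ev (x i)) (C.sum_repr ⟨g, hg⟩)
    rw [map_sum] at h2
    simp only [map_smul, hC] at h2
    simpa [ev] using h2
  simpa using congrArg Subtype.val h

/-- The Jacobson–Bourbaki argument. Let `E` be a finite-dimensional left `L`-space of additive maps
`L → L`, closed under composition and under precomposition with multiplications, and `F` the subfield
of the `z` for which `E` is `z`-linear. Then `L` is finite over `F`, with a basis whose coordinate
functions lie in `E`.  The identity is not assumed to be in `E`. -/
theorem exists_basis_coord_mem {L : Type*} [Field L] (E : Submodule L (L → L))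
    [FiniteDimensional L E] (hadd : ∀ f ∈ E, ∀ a b, f (a + b) = f a + f b)
    (hmul : ∀ f ∈ E, ∀ c, (fun b => f (c * b)) ∈ E)
    (hcomp : ∀ f ∈ E, ∀ g ∈ E, f ∘ g ∈ E) (hne : E ≠ ⊥) (F : Subfield L)
    (hF : ∀ z, z ∈ F ↔ ∀ f ∈ E, ∀ b, f (z * b) = z * f b) :
    ∃ (n : ℕ) (x : Module.Basis (Fin n) F L),
      ∀ i, (fun b => ((x.coord i b : F) : L)) ∈ E := by
  obtain ⟨n, x, f, hfE, hfx, hexp⟩ := exists_dual_points E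
  have hexp' : ∀ g ∈ E, ∀ b, g b = ∑ i, g (x i) * f i b := fun g hg b => by
    have := congrFun (hexp g hg) b
    simpa using this
  -- expanding `g (b * f i _) ∈ E` in the dual basis gives `g (b * f i c) = g b * f i c`
  have hfF : ∀ i c, f i c ∈ F := by
    intro i c
    rw [hF]
    intro g hg b
    have h1 := hexp' _ (hcomp _ (hmul g hg b) _ (hfE i)) c
    simp only [Function.comp, hfx] at h1
    rw [mul_comm, h1]
    rw [Finset.sum_eq_single i]
    · simp [mul_comm]
    · intro j _ hj
      rw [if_neg (Ne.symm hj), mul_zero]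
      have h0 : g 0 = 0 := by simpa using hadd g hg 0 0
      rw [h0, zero_mul]
    · simp
  let fl : Fin n → (L →ₗ[F] F) := fun i =>
    { toFun := fun b => ⟨f i b, hfF i b⟩
      map_add' := fun a b => Subtype.ext (hadd _ (hfE i) a b)
      map_smul' := fun z b => Subtype.ext ((hF z).1 z.2 _ (hfE i) b) }
  have hfl : ∀ i j, fl i (x j) = if i = j then 1 else 0 := fun i j =>
    Subtype.ext (by simp only [fl, LinearMap.coe_mk, AddHom.coe_mk, hfx]; split_ifs <;> rfl)
  have hsep : ∀ y, (∀ i, f i y = 0) → y = 0 := by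
    intro y hy
    by_contra hy0
    apply hne
    rw [eq_bot_iff]
    intro g hg
    refine funext fun b => ?_
    have h1 := hexp' _ (hmul g hg (b * y⁻¹)) y
    simp only [hy, mul_zero, Finset.sum_const_zero] at h1
    rwa [inv_mul_cancel_right₀ hy0] at h1
  have hsum : ∀ y, y = ∑ i, fl i y • x i := by
    intro y
    rw [← sub_eq_zero]
    refine hsep _ fun j => ?_
    have : fl j (y - ∑ i, fl i y • x i) = 0 := by
      rw [map_sub, map_sum]
      simp [hfl]
    exact congrArg Subtype.val this
  have hli : LinearIndependent F x := by
    rw [Fintype.linearIndependent_iff]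
    intro c hc i
    have := congrArg (fl i) hc
    rw [map_sum] at this
    simpa [hfl] using this
  let B : Module.Basis (Fin n) F L := Module.Basis.mk hli (by
    intro y _
    rw [hsum y]
    exact Submodule.sum_mem _ fun i _ => Submodule.smul_mem _ _ (Submodule.subset_span ⟨i, rfl⟩))
  refine ⟨n, B, fun i => ?_⟩
  have : (fun b => ((B.coord i b : F) : L)) = f i := by
    have h : B.coord i = fl i := B.ext fun j => by
      rw [Module.Basis.coord_apply, Module.Basis.repr_self, Module.Basis.mk_apply, hfl,
        Finsupp.single_apply]
      simp only [eq_comm]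
    rw [h]; rfl
  rw [this]; exact hfE i

/-! ### Maps out of the tensor product of bimodules -/

namespace BimodTensor

variable {A P Q Z : Type*} [CommRing A] [AddCommGroup P] [AddCommGroup Q] [AddCommGroup Z]
  [Module Aᵐᵒᵖ P] [Module A Q]

/-- The additive map out of `P ⊗_A Q` given by a balanced biadditive map. -/
noncomputable def lift (f : P →+ Q →+ Z) (hf : ∀ (a : A) p q, f (op a • p) q = f p (a • q)) :
    BimodTensor A P Q →+ Z :=
  TensorProduct.liftAddHom (R := A) (M := RightAct A P) (N := Q) f hf

@[simp]
theorem lift_tmul (f : P →+ Q →+ Z) (hf : ∀ (a : A) p q, f (op a • p) q = f p (a • q)) (p : P)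
    (q : Q) : lift f hf (tmul A p q) = f p q :=
  rfl

theorem tmul_induction {motive : BimodTensor A P Q → Prop} (t : BimodTensor A P Q)
    (zero : motive 0) (tmul : ∀ p q, motive (tmul A p q))
    (add : ∀ s t, motive s → motive t → motive (s + t)) : motive t :=
  TensorProduct.induction_on t zero tmul add

theorem tmul_add (p : P) (q q' : Q) : tmul A p (q + q') = tmul A p q + tmul A p q' :=
  TensorProduct.tmul_add (RightAct.of A P p) q q'

theorem sum_tmul {ι : Type*} (s : Finset ι) (p : ι → P) (q : Q) :
    tmul A (∑ i ∈ s, p i) q = ∑ i ∈ s, tmul A (p i) q :=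
  TensorProduct.sum_tmul s (fun i => RightAct.of A P (p i)) q

end BimodTensor

/-! ### Matrix coefficients of the right action -/

section Coefficients

variable {L P : Type*} [Field L] [AddCommGroup P] [Module L P] [Module Lᵐᵒᵖ P]
  {d : ℕ} (e : Module.Basis (Fin d) L P)

/-- The matrix of the right action in a left basis: `e i * b = ∑ j, rightCoeff e b i j * e j`. -/
noncomputable def rightCoeff (b : L) (i j : Fin d) : L :=
  e.repr (op b • e i) j

theorem sum_rightCoeff (b : L) (i : Fin d) : ∑ j, rightCoeff e b i j • e j = op b • e i :=
  e.sum_repr _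

theorem rightCoeff_one (i j : Fin d) : rightCoeff e 1 i j = if i = j then 1 else 0 := by
  simp [rightCoeff, Finsupp.single_apply]

theorem rightCoeff_zero (i j : Fin d) : rightCoeff e 0 i j = 0 := by
  simp [rightCoeff]

theorem rightCoeff_add (a b : L) (i j : Fin d) :
    rightCoeff e (a + b) i j = rightCoeff e a i j + rightCoeff e b i j := by
  simp [rightCoeff, add_smul]

/-- The left `L`-span of the entries of the matrix of the right action, as functions on `L`. -/
noncomputable def coeffSpan : Submodule L (L → L) :=
  Submodule.span L (Set.range fun (ij : Fin d × Fin d) b => rightCoeff e b ij.1 ij.2)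

theorem rightCoeff_mem (i j : Fin d) : (fun b => rightCoeff e b i j) ∈ coeffSpan e :=
  Submodule.subset_span ⟨(i, j), rfl⟩

instance : FiniteDimensional L (coeffSpan e) :=
  FiniteDimensional.span_of_finite L (Set.finite_range _)

theorem coeffSpan_map_add {f : L → L} (hf : f ∈ coeffSpan e) (a b : L) :
    f (a + b) = f a + f b := by
  induction hf using Submodule.span_induction with
  | mem f h => obtain ⟨ij, rfl⟩ := h; exact rightCoeff_add e a b _ _
  | zero => simp
  | add f g _ _ hf hg => simp only [Pi.add_apply, hf, hg]; ring
  | smul c f _ hf => simp only [Pi.smul_apply, hf, smul_add]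

theorem coeffSpan_ne_bot (hd : 1 ≤ d) : coeffSpan e ≠ ⊥ := by
  intro h
  have h1 := rightCoeff_mem e ⟨0, hd⟩ ⟨0, hd⟩
  rw [h, Submodule.mem_bot] at h1
  have := congrFun h1 1
  simp [rightCoeff_one] at this

variable [SMulCommClass L Lᵐᵒᵖ P]

theorem rightCoeff_mul (a b : L) (i j : Fin d) :
    rightCoeff e (a * b) i j = ∑ l, rightCoeff e a i l * rightCoeff e b l j := by
  have : op (a * b) • e i = ∑ l, rightCoeff e a i l • op b • e l := by
    rw [MulOpposite.op_mul, mul_smul, ← sum_rightCoeff e a i, Finset.smul_sum]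
    exact Finset.sum_congr rfl fun l _ => (smul_comm _ _ _).symm
  rw [rightCoeff, this, map_sum, Finsupp.finsetSum_apply]
  simp [rightCoeff]

/-- Every matrix coefficient `b ↦ φ (p b)`, for a left linear form `φ`, lies in `coeffSpan e`. -/
theorem apply_op_smul_mem (φ : P →ₗ[L] L) (p : P) : (fun b => φ (op b • p)) ∈ coeffSpan e := by
  have : (fun b => φ (op b • p)) =
      ∑ i, ∑ j, (e.repr p i * φ (e j)) • fun b => rightCoeff e b i j := by
    funext b
    conv_lhs => rw [← e.sum_repr p]
    simp only [Finset.smul_sum, map_sum, Finset.sum_apply, Pi.smul_apply, smul_eq_mul]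
    refine Finset.sum_congr rfl fun i _ => ?_
    rw [← smul_comm, map_smul, ← sum_rightCoeff, map_sum, smul_eq_mul, Finset.mul_sum]
    refine Finset.sum_congr rfl fun j _ => ?_
    rw [map_smul, smul_eq_mul]
    ring
  rw [this]
  exact Submodule.sum_mem _ fun i _ => Submodule.sum_mem _ fun j _ =>
    Submodule.smul_mem _ _ (rightCoeff_mem e i j)

theorem coeffSpan_comp_mul {f : L → L} (hf : f ∈ coeffSpan e) (c : L) :
    (fun b => f (c * b)) ∈ coeffSpan e := by
  induction hf using Submodule.span_induction with
  | mem f h =>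
    obtain ⟨⟨i, j⟩, rfl⟩ := h
    have : (fun b => rightCoeff e (c * b) i j) =
        ∑ l, rightCoeff e c i l • fun b => rightCoeff e b l j := by
      funext b
      simp [rightCoeff_mul]
    rw [this]
    exact Submodule.sum_mem _ fun l _ => Submodule.smul_mem _ _ (rightCoeff_mem e l j)
  | zero => exact Submodule.zero_mem _
  | add f g _ _ hf hg => exact Submodule.add_mem _ hf hg
  | smul c f _ hf => exact Submodule.smul_mem _ _ hf

theorem mem_bimodCenter_iff (z : L) :
    z ∈ bimodCenter L P ↔ ∀ f ∈ coeffSpan e, ∀ b, f (z * b) = z * f b := by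
  constructor
  · intro hz f hf b
    induction hf using Submodule.span_induction with
    | mem f h =>
      obtain ⟨ij, rfl⟩ := h
      have h1 : ∀ x : P, z • x = op z • x := hz
      change e.repr (op (z * b) • e ij.1) ij.2 = z * e.repr (op b • e ij.1) ij.2
      rw [mul_comm z b, MulOpposite.op_mul, mul_smul, ← h1, map_smul]
      rfl
    | zero => simp
    | add f g _ _ hf hg => simp only [Pi.add_apply, hf, hg]; ring
    | smul c f _ hf => simp only [Pi.smul_apply, hf, smul_eq_mul]; ring
  · intro h x
    refine e.ext_elem fun i => ?_
    have := h _ (apply_op_smul_mem e (e.coord i) x) 1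
    simpa using this.symm

/-- A composite of matrix coefficients of `P` is a matrix coefficient of `P ⊗ P`, hence of `P` when
`P ⊗ P` is a power of `P`. -/
theorem comp_mem_coeffSpan (Φ : BimodEquiv L (BimodTensor L P P) (Fin d → P)) {f g : L → L}
    (hf : f ∈ coeffSpan e) (hg : g ∈ coeffSpan e) : f ∘ g ∈ coeffSpan e := by
  -- first the case of two matrix coefficients `φ (p ·)` and `φ' (q ·)`
  have key : ∀ (φ φ' : P →ₗ[L] L) (p q : P),
      (fun b => φ (op (φ' (op b • q)) • p)) ∈ coeffSpan e := by
    intro φ φ' p q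
    -- `p ⊗ q ↦ φ (p φ'(q))` is balanced and left linear, and `φ (p φ'(q b)) = Λ ((p ⊗ q) b)`
    let Λ : BimodTensor L P P →+ L := BimodTensor.lift
      (AddMonoidHom.mk' (fun p => AddMonoidHom.mk' (fun q => φ (op (φ' q) • p))
        (fun q q' => by simp [add_smul]))
        (fun p p' => by ext q; simp))
      (fun (a : L) p q => by
        simp only [AddMonoidHom.mk'_apply, map_smul, smul_eq_mul]
        rw [mul_comm, ← mul_smul, ← MulOpposite.op_mul, mul_comm])
    have hΛ : ∀ (a : L) t, Λ (a • t) = a * Λ t := by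
      intro a t
      induction t using BimodTensor.tmul_induction with
      | zero => simp
      | tmul p q =>
        rw [BimodTensor.left_smul_tmul, BimodTensor.lift_tmul, BimodTensor.lift_tmul]
        simp only [AddMonoidHom.mk'_apply]
        rw [← smul_comm, map_smul, smul_eq_mul]
      | add s t hs ht => rw [smul_add, map_add, hs, ht, map_add, mul_add]
    have hsymm : ∀ (a : L) t, Φ.toAddEquiv.symm (a • t) = a • Φ.toAddEquiv.symm t := by
      intro a t
      rw [AddEquiv.symm_apply_eq]
      have := Φ.map_left a (Φ.toAddEquiv.symm t)
      change Φ.toAddEquiv _ = a • Φ.toAddEquiv _ at this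
      rw [this, AddEquiv.apply_symm_apply]
    let φi : Fin d → P →ₗ[L] L := fun i =>
      { toFun := fun x => Λ (Φ.toAddEquiv.symm (Pi.single i x))
        map_add' := fun x y => by rw [Pi.single_add, map_add, map_add]
        map_smul' := fun a x => by rw [Pi.single_smul, hsymm, hΛ]; rfl }
    let T : Fin d → P := Φ.toAddEquiv (BimodTensor.tmul L p q)
    have h : (fun b : L => φ (op (φ' (op b • q)) • p)) = ∑ i, fun b : L => φi i (op b • T i) := by
      funext b
      have h1 : (φ (op (φ' (op b • q)) • p) : L) = Λ (op b • BimodTensor.tmul L p q) := by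
        rw [BimodTensor.right_smul_tmul, BimodTensor.lift_tmul]; rfl
      have h2 : op b • BimodTensor.tmul L p q = Φ.toAddEquiv.symm (op b • T) := by
        rw [AddEquiv.eq_symm_apply]
        exact Φ.map_right b _
      rw [h1, h2, ← Finset.univ_sum_single (op b • T), map_sum, map_sum, Finset.sum_apply]
      rfl
    rw [h]
    exact Submodule.sum_mem _ fun i _ => apply_op_smul_mem e (φi i) (T i)
  induction hg using Submodule.span_induction generalizing f with
  | mem g h =>
    obtain ⟨⟨k, l⟩, rfl⟩ := h
    induction hf using Submodule.span_induction with
    | mem f h => obtain ⟨⟨i, j⟩, rfl⟩ := h; exact key (e.coord j) (e.coord l) (e i) (e k)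
    | zero => exact Submodule.zero_mem _
    | add f f' _ _ hf hf' => exact Submodule.add_mem _ hf hf'
    | smul c f _ hf => exact Submodule.smul_mem _ c hf
  | zero =>
    have h0 : f 0 = 0 := by simpa using coeffSpan_map_add e hf 0 0
    have : f ∘ (0 : L → L) = 0 := funext fun _ => h0
    rw [this]
    exact Submodule.zero_mem _
  | add g g' _ _ hg hg' =>
    have : f ∘ (g + g') = f ∘ g + f ∘ g' := funext fun b => coeffSpan_map_add e hf _ _
    rw [this]
    exact Submodule.add_mem _ (hg hf) (hg' hf)
  | smul c g _ hg => exact hg (coeffSpan_comp_mul e hf c)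

end Coefficients

/-! ### Bimodule maps into a vector space -/

section BimodHoms

variable {L P κ Z : Type*} [Field L] [AddCommGroup P] [Module L P] [Module Lᵐᵒᵖ P]
  [Field κ] [AddCommGroup Z] [Module κ Z]

variable (P) in
/-- The maps from the bimodule `P` to the `κ`-space `Z` that are additive, left linear through the
action `θ` of `L` on `Z`, and right linear through `τ : L → κ`; a `κ`-subspace of all functions. -/
def bimodHoms (θ : L →+* Module.End κ Z) (τ : L →+* κ) : Submodule κ (P → Z) where
  carrier := {w | (∀ p q, w (p + q) = w p + w q) ∧ (∀ (a : L) p, w (a • p) = θ a (w p)) ∧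
    ∀ (b : L) p, w (op b • p) = τ b • w p}
  add_mem' := by
    rintro v w ⟨hv1, hv2, hv3⟩ ⟨hw1, hw2, hw3⟩
    refine ⟨fun p q => ?_, fun a p => ?_, fun b p => ?_⟩
    · simp only [Pi.add_apply, hv1, hw1]; abel
    · simp only [Pi.add_apply, hv2, hw2, map_add]
    · simp only [Pi.add_apply, hv3, hw3, smul_add]
  zero_mem' := by simp
  smul_mem' := by
    rintro c w ⟨hw1, hw2, hw3⟩
    refine ⟨fun p q => ?_, fun a p => ?_, fun b p => ?_⟩
    · simp only [Pi.smul_apply, hw1, smul_add]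
    · simp only [Pi.smul_apply, hw2, map_smul]
    · simp only [Pi.smul_apply, hw3, smul_comm c]

variable {d : ℕ} (e : Module.Basis (Fin d) L P) {θ : L →+* Module.End κ Z} {τ : L →+* κ}

theorem bimodHoms_map_sum {w : P → Z} (hw : w ∈ bimodHoms P θ τ) {ι : Type*} (s : Finset ι)
    (p : ι → P) : w (∑ i ∈ s, p i) = ∑ i ∈ s, w (p i) :=
  map_sum (AddMonoidHom.mk' w hw.1) p s

/-- Evaluation of bimodule maps at finitely many points. -/
def bimodHomsEval (θ : L →+* Module.End κ Z) (τ : L →+* κ) (p : Fin d → P) :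
    bimodHoms P θ τ →ₗ[κ] (Fin d → Z) where
  toFun w i := (w : P → Z) (p i)
  map_add' _ _ := rfl
  map_smul' _ _ := rfl

theorem bimodHomsEval_injective (θ : L →+* Module.End κ Z) (τ : L →+* κ) :
    Function.Injective (bimodHomsEval θ τ e) := by
  rw [← LinearMap.ker_eq_bot, LinearMap.ker_eq_bot']
  intro w hw
  refine Subtype.ext (funext fun p => ?_)
  rw [← e.sum_repr p, bimodHoms_map_sum w.2]
  refine Finset.sum_eq_zero fun i _ => ?_
  rw [w.2.2.1]
  have : (w : P → Z) (e i) = 0 := congrFun hw i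
  rw [this, map_zero]

include e in
theorem finite_bimodHoms [FiniteDimensional κ Z] (θ : L →+* Module.End κ Z) (τ : L →+* κ) :
    FiniteDimensional κ (bimodHoms P θ τ) :=
  Module.Finite.of_injective _ (bimodHomsEval_injective e θ τ)

include e in
theorem finrank_bimodHoms_le [FiniteDimensional κ Z] (θ : L →+* Module.End κ Z) (τ : L →+* κ) :
    Module.finrank κ (bimodHoms P θ τ) ≤ d * Module.finrank κ Z := by
  have := LinearMap.finrank_le_finrank_of_injective (bimodHomsEval_injective e θ τ)
  simpa [Module.finrank_pi_fintype] using this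

variable [SMulCommClass L Lᵐᵒᵖ P]

/-- The action of `L` on the left linear maps `P ^ d → Z` that comes from the right action on `P ^ d`.
Such a map is encoded as `g : Fin d → Fin d → Z`, where `g i j` is its value at the basis vector `e j`
of the `i`-th copy of `P`. -/
noncomputable def coind (θ : L →+* Module.End κ Z) :
    L →+* Module.End κ (Fin d → Fin d → Z) where
  toFun b :=
    { toFun := fun g i j => ∑ l, θ (rightCoeff e b j l) (g i l)
      map_add' := fun g g' => by
        funext i j; simp [Finset.sum_add_distrib]
      map_smul' := fun c g => by
        funext i j; simp [Finset.smul_sum] }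
  map_one' := by
    refine LinearMap.ext fun g => funext fun i => funext fun j => ?_
    simp only [LinearMap.coe_mk, AddHom.coe_mk, rightCoeff_one]
    rw [Finset.sum_eq_single j (fun l _ hl => by simp [hl.symm]) (by simp)]
    simp
  map_mul' a b := by
    refine LinearMap.ext fun g => funext fun i => funext fun j => ?_
    simp only [LinearMap.coe_mk, AddHom.coe_mk, Module.End.mul_apply, rightCoeff_mul, map_sum,
      map_mul, LinearMap.sum_apply]
    exact Finset.sum_comm
  map_zero' := by
    refine LinearMap.ext fun g => funext fun i => funext fun j => ?_
    simp [rightCoeff_zero]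
  map_add' a b := by
    refine LinearMap.ext fun g => funext fun i => funext fun j => ?_
    simp [rightCoeff_add, Finset.sum_add_distrib]

theorem coind_apply (θ : L →+* Module.End κ Z) (b : L) (g : Fin d → Fin d → Z) (i j : Fin d) :
    coind e θ b g i j = ∑ l, θ (rightCoeff e b j l) (g i l) :=
  rfl

/-- `Hom(P, Hom_left (P ^ d, Z)) ≅ Hom(P ^ d ⊗ P, Z)` contains `Hom(P, Z) ^ (d * d)` when
`P ⊗ P ≅ P ^ d`. -/
theorem le_finrank_bimodHoms_coind [FiniteDimensional κ Z]
    (Φ : BimodEquiv L (BimodTensor L P P) (Fin d → P)) (θ : L →+* Module.End κ Z) (τ : L →+* κ) :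
    d * d * Module.finrank κ (bimodHoms P θ τ) ≤
      Module.finrank κ (bimodHoms P (coind e θ) τ) := by
  have := finite_bimodHoms e θ τ
  have := finite_bimodHoms e (coind e θ) τ
  have hadd : ∀ s t i, Φ.toFun (s + t) i = Φ.toFun s i + Φ.toFun t i := fun s t i =>
    congrFun (Φ.toAddEquiv.map_add s t) i
  -- the forms `q ⊗ p ↦ ∑ i, w a i (Φ (q ⊗ p) i)` on the copies `a` of `P ⊗ P`
  let T : (Fin d → Fin d → bimodHoms P θ τ) →ₗ[κ] bimodHoms P (coind e θ) τ :=
    { toFun := fun w => ⟨fun p a j =>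
          ∑ i, (w a i : P → Z) (Φ.toFun (BimodTensor.tmul L (e j) p) i), by
        refine ⟨fun p q => ?_, fun b p => ?_, fun b p => ?_⟩
        · funext a j
          simp only [BimodTensor.tmul_add, hadd, (w _ _).2.1, Finset.sum_add_distrib, Pi.add_apply]
        · funext a j
          rw [coind_apply]
          have h : BimodTensor.tmul L (e j) (b • p) =
              ∑ l, rightCoeff e b j l • BimodTensor.tmul L (e l) p := by
            rw [← BimodTensor.op_smul_tmul, ← sum_rightCoeff, BimodTensor.sum_tmul]
            rfl
          have h2 : Φ.toFun (∑ l, rightCoeff e b j l • BimodTensor.tmul L (e l) p) =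
              ∑ l, rightCoeff e b j l • Φ.toFun (BimodTensor.tmul L (e l) p) := by
            simp only [← Φ.map_left]
            exact map_sum Φ.toAddEquiv _ _
          beta_reduce
          rw [h, h2]
          simp only [Finset.sum_apply, Pi.smul_apply, map_sum]
          rw [Finset.sum_comm]
          refine Finset.sum_congr rfl fun i _ => ?_
          rw [bimodHoms_map_sum (w a i).2]
          exact Finset.sum_congr rfl fun l _ => (w a i).2.2.1 _ _
        · funext a j
          simp only [← BimodTensor.right_smul_tmul, Φ.map_right, Pi.smul_apply, (w _ _).2.2.2,
            Finset.smul_sum]⟩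
      map_add' := fun v w => Subtype.ext (funext fun p => funext fun a => funext fun j => by
        simp [Finset.sum_add_distrib])
      map_smul' := fun c w => Subtype.ext (funext fun p => funext fun a => funext fun j => by
        simp [Finset.smul_sum]) }
  have hT : Function.Injective T := by
    rw [← LinearMap.ker_eq_bot, LinearMap.ker_eq_bot']
    intro w hw
    have h0 : ∀ p a j, ∑ i, (w a i : P → Z) (Φ.toFun (BimodTensor.tmul L (e j) p) i) = 0 :=
      fun p a j => congrFun (congrFun (congrFun (congrArg Subtype.val hw) p) a) j
    -- the sum vanishes on the whole tensor product, not only on the `e j ⊗ p`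
    have h1 : ∀ a t, ∑ i, (w a i : P → Z) (Φ.toFun t i) = 0 := by
      intro a
      let ev : BimodTensor L P P →+ Z := AddMonoidHom.mk'
        (fun t => ∑ i, (w a i : P → Z) (Φ.toFun t i))
        (fun s t => by simp only [hadd, (w _ _).2.1, Finset.sum_add_distrib])
      intro t
      change ev t = 0
      induction t using BimodTensor.tmul_induction with
      | zero => exact map_zero ev
      | tmul q p =>
        rw [← e.sum_repr q, BimodTensor.sum_tmul, map_sum]
        refine Finset.sum_eq_zero fun j _ => ?_
        rw [← BimodTensor.left_smul_tmul]
        change ∑ i, (w a i : P → Z) (Φ.toFun (_ • _) i) = 0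
        simp only [Φ.map_left, Pi.smul_apply, (w _ _).2.2.1]
        rw [← map_sum, h0, map_zero]
      | add s t hs ht => rw [map_add, hs, ht, add_zero]
    funext a i
    refine Subtype.ext (funext fun p => ?_)
    have h2 := h1 a (Φ.toAddEquiv.symm (Pi.single i p))
    have h3 : Φ.toFun (Φ.toAddEquiv.symm (Pi.single i p)) = Pi.single i p :=
      Φ.toAddEquiv.apply_symm_apply _
    rw [h3, Finset.sum_eq_single i] at h2
    · simpa using h2
    · intro k _ hk
      rw [Pi.single_eq_of_ne hk]
      simpa using (w a k).2.1 0 0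
    · simp
  have := LinearMap.finrank_le_finrank_of_injective hT
  simpa [Module.finrank_pi_fintype, mul_assoc] using this

end BimodHoms

/-! ### The bound on the number of bimodule maps -/

section Bound

universe u v

variable {L κ : Type u} {P : Type v} [Field L] [AddCommGroup P] [Module L P] [Module Lᵐᵒᵖ P]
  [Field κ] {d n : ℕ} (e : Module.Basis (Fin d) L P)
  {F : Subfield L} (x : Module.Basis (Fin n) F L)

section

variable {Z : Type*} [AddCommGroup Z] [Module κ Z]

/-- The map sending a left linear `g : P ^ d → Z` to its values at the vectors `(e 1, …, e d) * x t`.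
Its kernel is the space of the `g` that vanish on the sub-bimodule generated by `(e 1, …, e d)`, by
`mem_ker_diagEval_iff`. -/
noncomputable def diagEval (θ : L →+* Module.End κ Z) :
    (Fin d → Fin d → Z) →ₗ[κ] (Fin n → Z) where
  toFun g t := ∑ i, ∑ j, θ (rightCoeff e (x t) i j) (g i j)
  map_add' g g' := by
    funext t; simp [Finset.sum_add_distrib]
  map_smul' c g := by
    funext t; simp [Finset.smul_sum]

theorem diagEval_surjective
    (hmem : ∀ t, (fun b => ((x.coord t b : F) : L)) ∈ coeffSpan e) (θ : L →+* Module.End κ Z) :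
    Function.Surjective (diagEval e x θ) := by
  have : ∀ t, ∃ c : Fin d × Fin d → L, ∀ b,
      ∑ ij, c ij * rightCoeff e b ij.1 ij.2 = (x.coord t b : L) := fun t => by
    obtain ⟨c, hc⟩ := (Submodule.mem_span_range_iff_exists_fun L).1 (hmem t)
    exact ⟨c, fun b => by simpa using congrFun hc b⟩
  choose c hc using this
  intro z
  refine ⟨fun i j => ∑ t, θ (c t (i, j)) (z t), funext fun s => ?_⟩
  calc ∑ i, ∑ j, θ (rightCoeff e (x s) i j) (∑ t, θ (c t (i, j)) (z t))
      = ∑ t, θ (∑ ij, c t ij * rightCoeff e (x s) ij.1 ij.2) (z t) := by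
        simp only [map_sum, Fintype.sum_prod_type, LinearMap.sum_apply]
        conv_rhs => rw [Finset.sum_comm]
        refine Finset.sum_congr rfl fun i _ => ?_
        conv_rhs => rw [Finset.sum_comm]
        refine Finset.sum_congr rfl fun j _ => Finset.sum_congr rfl fun t _ => ?_
        rw [mul_comm, map_mul, Module.End.mul_apply]
    _ = z s := by
        simp only [hc, Module.Basis.coord_apply, Module.Basis.repr_self]
        rw [Finset.sum_eq_single s]
        · simp
        · intro t _ ht
          simp [Finsupp.single_eq_of_ne ht]
        · simp

theorem finrank_ker_diagEval [FiniteDimensional κ Z]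
    (hmem : ∀ t, (fun b => ((x.coord t b : F) : L)) ∈ coeffSpan e) (θ : L →+* Module.End κ Z) :
    n * Module.finrank κ Z + Module.finrank κ (LinearMap.ker (diagEval e x θ)) =
      d * d * Module.finrank κ Z := by
  have := LinearMap.finrank_range_add_finrank_ker (diagEval e x θ)
  rw [LinearMap.range_eq_top.2 (diagEval_surjective e x hmem θ), finrank_top] at this
  simpa [Module.finrank_pi_fintype, mul_assoc] using this

variable [SMulCommClass L Lᵐᵒᵖ P]

theorem mem_ker_diagEval_iff
    (hx : ∀ (z : F) (b : L) (i j), rightCoeff e (z * b) i j = z * rightCoeff e b i j)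
    (θ : L →+* Module.End κ Z) (g : Fin d → Fin d → Z) :
    g ∈ LinearMap.ker (diagEval e x θ) ↔ ∀ b, ∑ i, coind e θ b g i i = 0 := by
  constructor
  · intro hg b
    have hb : ∀ i j, rightCoeff e b i j = ∑ t, (x.repr b t : L) * rightCoeff e (x t) i j := by
      intro i j
      simp only [← hx]
      conv_lhs => rw [← x.sum_repr b]
      exact map_sum (AddMonoidHom.mk' (fun b => rightCoeff e b i j)
        fun a b => rightCoeff_add e a b i j) _ _
    have h1 : ∀ t, ∑ i, ∑ j, θ (rightCoeff e (x t) i j) (g i j) = 0 := fun t => congrFun hg t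
    simp only [coind_apply, hb, map_sum, map_mul, LinearMap.sum_apply, Module.End.mul_apply]
    calc _ = ∑ t, θ (x.repr b t) (∑ i, ∑ j, θ (rightCoeff e (x t) i j) (g i j)) := by
          simp only [map_sum]
          conv_rhs => rw [Finset.sum_comm]
          exact Finset.sum_congr rfl fun i _ => Finset.sum_comm
      _ = 0 := by simp [h1]
  · intro h
    funext t
    exact h (x t)

theorem coind_mem_ker_diagEval
    (hx : ∀ (z : F) (b : L) (i j), rightCoeff e (z * b) i j = z * rightCoeff e b i j)
    (θ : L →+* Module.End κ Z) (a : L) (g : Fin d → Fin d → Z)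
    (hg : g ∈ LinearMap.ker (diagEval e x θ)) :
    coind e θ a g ∈ LinearMap.ker (diagEval e x θ) := by
  rw [mem_ker_diagEval_iff e x hx] at hg ⊢
  intro b
  rw [← Module.End.mul_apply, ← map_mul]
  exact hg _

/-- The restriction of the action `coind e θ` to the kernel of `diagEval e x θ`. -/
noncomputable def coindKer
    (hx : ∀ (z : F) (b : L) (i j), rightCoeff e (z * b) i j = z * rightCoeff e b i j)
    (θ : L →+* Module.End κ Z) : L →+* Module.End κ (LinearMap.ker (diagEval e x θ)) where
  toFun a := (coind e θ a).restrict (coind_mem_ker_diagEval e x hx θ a)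
  map_one' := LinearMap.ext fun g => Subtype.ext (by simp)
  map_mul' a b := LinearMap.ext fun g => Subtype.ext (by simp)
  map_zero' := LinearMap.ext fun g => Subtype.ext (by simp)
  map_add' a b := LinearMap.ext fun g => Subtype.ext (by simp)

/-- `Hom(P, W)` modulo the maps into the kernel of `diagEval` embeds into `Hom_right (P, Z)`; the family
`e'` generates `P` as a right space, so that a right linear map is determined by its values on it. -/
theorem finrank_bimodHoms_coind_le [FiniteDimensional κ Z]
    (hx : ∀ (z : F) (b : L) (i j), rightCoeff e (z * b) i j = z * rightCoeff e b i j)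
    (e' : Fin d → P) (he' : ∀ p, ∃ c : Fin d → L, p = ∑ i, op (c i) • e' i)
    (θ : L →+* Module.End κ Z) (τ : L →+* κ) :
    Module.finrank κ (bimodHoms P (coind e θ) τ) ≤
      Module.finrank κ (bimodHoms P (coindKer e x hx θ) τ) + d * Module.finrank κ Z := by
  have := finite_bimodHoms e (coind e θ) τ
  have := finite_bimodHoms e (coindKer e x hx θ) τ
  -- `w` is sent to the right linear map `p ↦ w p (e 1, …, e d)`, recorded by its values on `e'`
  let R : bimodHoms P (coind e θ) τ →ₗ[κ] (Fin d → Z) :=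
    { toFun := fun w s => ∑ i, (w : P → Fin d → Fin d → Z) (e' s) i i
      map_add' := fun v w => funext fun s => by simp [Finset.sum_add_distrib]
      map_smul' := fun c w => funext fun s => by simp [Finset.smul_sum] }
  have hR : ∀ w ∈ LinearMap.ker R, ∀ p,
      (w : P → Fin d → Fin d → Z) p ∈ LinearMap.ker (diagEval e x θ) := by
    intro w hw
    have h1 : ∀ p, ∑ i, (w : P → Fin d → Fin d → Z) p i i = 0 := by
      intro p
      obtain ⟨c, rfl⟩ := he' p
      rw [bimodHoms_map_sum w.2]
      simp only [w.2.2.2, Finset.sum_apply, Pi.smul_apply]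
      rw [Finset.sum_comm]
      refine Finset.sum_eq_zero fun s _ => ?_
      rw [← Finset.smul_sum]
      have : ∑ i, (w : P → Fin d → Fin d → Z) (e' s) i i = 0 := congrFun hw s
      rw [this, smul_zero]
    intro p
    rw [mem_ker_diagEval_iff e x hx]
    intro b
    rw [← w.2.2.1]
    exact h1 _
  let T : LinearMap.ker R →ₗ[κ] bimodHoms P (coindKer e x hx θ) τ :=
    { toFun := fun w => ⟨fun p => ⟨(w.1 : P → Fin d → Fin d → Z) p, hR w.1 w.2 p⟩,
        fun p q => Subtype.ext (w.1.2.1 p q), fun a p => Subtype.ext (w.1.2.2.1 a p),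
        fun b p => Subtype.ext (w.1.2.2.2 b p)⟩
      map_add' := fun _ _ => rfl
      map_smul' := fun _ _ => rfl }
  have hT : Function.Injective T := by
    intro v w h
    refine Subtype.ext (Subtype.ext (funext fun p => ?_))
    exact congrArg Subtype.val (congrFun (congrArg Subtype.val h) p)
  have h1 := LinearMap.finrank_le_finrank_of_injective hT
  have h2 := LinearMap.finrank_range_add_finrank_ker R
  have h3 := (LinearMap.range R).finrank_le
  have h4 : Module.finrank κ (Fin d → Z) = d * Module.finrank κ Z := by
    simp [Module.finrank_pi_fintype]
  omega

end

/-- `n * dim Hom(P, Z) ≤ d * dim Z`, where `n` is the degree of `L` over the center. -/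
theorem mul_finrank_bimodHoms_le [SMulCommClass L Lᵐᵒᵖ P] (hd : 1 ≤ d)
    (Φ : BimodEquiv L (BimodTensor L P P) (Fin d → P))
    (e' : Fin d → P) (he' : ∀ p, ∃ c : Fin d → L, p = ∑ i, op (c i) • e' i)
    (hx : ∀ (z : F) (b : L) (i j), rightCoeff e (z * b) i j = z * rightCoeff e b i j)
    (hmem : ∀ t, (fun b => ((x.coord t b : F) : L)) ∈ coeffSpan e)
    {Z : Type u} [AddCommGroup Z] [Module κ Z] [FiniteDimensional κ Z]
    (θ : L →+* Module.End κ Z) (τ : L →+* κ) :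
    n * Module.finrank κ (bimodHoms P θ τ) ≤ d * Module.finrank κ Z := by
  -- the constants `c` with `dim Hom(P, Z) ≤ c * dim Z` for all `Z`
  let A : Set ℝ := {c | ∀ (Z : Type u) [AddCommGroup Z] [Module κ Z] [FiniteDimensional κ Z]
    (θ : L →+* Module.End κ Z), (Module.finrank κ (bimodHoms P θ τ) : ℝ) ≤ c * Module.finrank κ Z}
  have hA : (d : ℝ) ∈ A := fun Z _ _ _ θ => by
    exact_mod_cast finrank_bimodHoms_le e θ τ
  have hA0 : ∀ c ∈ A, 0 ≤ c := fun c hc => by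
    have h := hc κ ((Module.toModuleEnd κ (S := κ) κ).comp τ)
    simp only [Module.finrank_self, Nat.cast_one, mul_one] at h
    exact (Nat.cast_nonneg _).trans h
  have hbdd : BddBelow A := ⟨0, hA0⟩
  -- the least such constant
  set c := sInf A
  have hc : c ∈ A := by
    intro Z _ _ _ θ
    rcases Nat.eq_zero_or_pos (Module.finrank κ Z) with h0 | h0
    · have := finrank_bimodHoms_le e θ τ
      rw [h0, mul_zero] at this
      simp [h0, Nat.le_zero.1 this]
    · have h0' : (0 : ℝ) < Module.finrank κ Z := by exact_mod_cast h0
      rw [← div_le_iff₀ h0']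
      exact le_csInf ⟨_, hA⟩ fun b hb => (div_le_iff₀ h0').2 (hb Z θ)
  have hd' : (0 : ℝ) < d * d := by
    have : (0 : ℝ) < d := by exact_mod_cast hd
    positivity
  -- if `c` is such a constant, so is the one on the left, by the filtration of `Hom(P, W)`
  have step : (c * (d * d - n) + d) / (d * d) ∈ A := by
    intro Z _ _ _ θ
    have h1 : (d * d * Module.finrank κ (bimodHoms P θ τ) : ℝ) ≤
        Module.finrank κ (bimodHoms P (coind e θ) τ) := by
      exact_mod_cast le_finrank_bimodHoms_coind e Φ θ τ
    have h2 : (Module.finrank κ (bimodHoms P (coind e θ) τ) : ℝ) ≤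
        Module.finrank κ (bimodHoms P (coindKer e x hx θ) τ) + d * Module.finrank κ Z := by
      exact_mod_cast finrank_bimodHoms_coind_le e x hx e' he' θ τ
    have h3 := hc _ (coindKer e x hx θ)
    have h4 : (n * Module.finrank κ Z + Module.finrank κ (LinearMap.ker (diagEval e x θ)) : ℝ) =
      d * d * Module.finrank κ Z := by
      exact_mod_cast finrank_ker_diagEval e x hmem θ
    rw [div_mul_eq_mul_div, le_div_iff₀ hd']
    have h5 : (Module.finrank κ (LinearMap.ker (diagEval e x θ)) : ℝ) =
      (d * d - n) * Module.finrank κ Z := by linear_combination h4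
    rw [h5] at h3
    linarith
  have hle := csInf_le hbdd step
  rw [le_div_iff₀ hd'] at hle
  have hcn : n * c ≤ d := by linarith
  have h := hc Z θ
  have : (n * Module.finrank κ (bimodHoms P θ τ) : ℝ) ≤ d * Module.finrank κ Z :=
    calc (n * Module.finrank κ (bimodHoms P θ τ) : ℝ) ≤ n * (c * Module.finrank κ Z) := by gcongr
      _ = n * c * Module.finrank κ Z := by ring
      _ ≤ d * Module.finrank κ Z := by gcongr
  exact_mod_cast this

end Bound

/-! ### Generators over a semilocal ring -/

/-- Over a semilocal ring, the number of generators of a finite module is the maximum of the numbers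
needed modulo the maximal ideals. -/
theorem exists_fin_span_eq_top {S M : Type*} [CommRing S] [AddCommGroup M] [Module S M]
    [Module.Finite S M] [Finite (MaximalSpectrum S)] (r : ℕ)
    (h : ∀ m : MaximalSpectrum S,
      Module.finrank (S ⧸ m.asIdeal) (M ⧸ (m.asIdeal • ⊤ : Submodule S M)) ≤ r) :
    ∃ g : Fin r → M, Submodule.span S (Set.range g) = ⊤ := by
  classical
  have hloc : ∀ m : MaximalSpectrum S, ∃ v : Fin r → M,
      ⊤ ≤ Submodule.span S (Set.range v) ⊔ (m.asIdeal • ⊤ : Submodule S M) := by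
    intro m
    let _ : Field (S ⧸ m.asIdeal) := Ideal.Quotient.field m.asIdeal
    let N : Submodule S M := m.asIdeal • ⊤
    let b := Module.finBasis (S ⧸ m.asIdeal) (M ⧸ N)
    choose w hw using fun i => Submodule.mkQ_surjective N (b i)
    refine ⟨fun i => if hi : (i : ℕ) < _ then w ⟨i, hi⟩ else 0, fun p _ => ?_⟩
    have hlt : ∀ i : Fin (Module.finrank (S ⧸ m.asIdeal) (M ⧸ N)), (i : ℕ) < r :=
      fun i => i.2.trans_le (h m)
    choose s hs using fun i => Ideal.Quotient.mk_surjective (b.repr (N.mkQ p) i)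
    have hp : p - ∑ i, s i • w i ∈ N := by
      refine (Submodule.Quotient.mk_eq_zero N).1 (?_ : N.mkQ _ = 0)
      rw [map_sub, map_sum, sub_eq_zero]
      conv_lhs => rw [← b.sum_repr (N.mkQ p)]
      refine Finset.sum_congr rfl fun i _ => ?_
      rw [map_smul, hw, ← hs]
      rfl
    rw [← add_sub_cancel (∑ i, s i • w i) p]
    refine Submodule.add_mem _ (Submodule.mem_sup_left (Submodule.sum_mem _ fun i _ =>
      Submodule.smul_mem _ _ (Submodule.subset_span ⟨⟨i, hlt i⟩, ?_⟩))) (Submodule.mem_sup_right hp)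
    exact dif_pos i.2
  choose v hv using hloc
  have hcop : Pairwise (Function.onFun IsCoprime fun m : MaximalSpectrum S => m.asIdeal) :=
    fun _ _ ne => Ideal.isCoprime_of_isMaximal (MaximalSpectrum.ext_iff.ne.mp ne)
  have : Fintype (MaximalSpectrum S) := Fintype.ofFinite _
  choose ε hε using fun m : MaximalSpectrum S =>
    Ideal.exists_forall_sub_mem_ideal hcop (Pi.single m 1)
  -- `g i` is congruent to `v m i` modulo each `m`
  let g : Fin r → M := fun i => ∑ m, ε m • v m i
  refine ⟨g, ?_⟩
  set N := Submodule.span S (Set.range g)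
  have hN : ∀ m : MaximalSpectrum S, ⊤ ≤ N ⊔ (m.asIdeal • ⊤ : Submodule S M) := by
    intro m
    refine (hv m).trans (sup_le ?_ le_sup_right)
    rw [Submodule.span_le]
    rintro _ ⟨i, rfl⟩
    have h1 : v m i = g i - ∑ k, (ε k - (Pi.single k 1 : MaximalSpectrum S → S) m) • v k i := by
      have : ∑ k, (Pi.single k 1 : MaximalSpectrum S → S) m • v k i = v m i := by
        rw [Finset.sum_eq_single m]
        · simp
        · intro k _ hk; simp [Pi.single_eq_of_ne hk.symm]
        · simp
      simp only [sub_smul, Finset.sum_sub_distrib, this, g]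
      abel
    rw [SetLike.mem_coe, h1]
    refine Submodule.sub_mem _ (Submodule.mem_sup_left (Submodule.subset_span ⟨i, rfl⟩))
      (Submodule.mem_sup_right (Submodule.sum_mem _ fun k _ =>
        Submodule.smul_mem_smul (hε k m) trivial))
  -- the quotient by the span is finite and equal to its product with every maximal ideal
  have hann : Module.annihilator S (M ⧸ N) = ⊤ := by
    by_contra hne
    obtain ⟨m, hm, hle⟩ := Ideal.exists_le_maximal _ hne
    have h2 : (⊤ : Submodule S (M ⧸ N)) ≤ m • ⊤ := by
      have := Submodule.map_mono (f := N.mkQ) (hN ⟨m, hm⟩)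
      rwa [Submodule.map_sup, Submodule.map_smul'', Submodule.map_top, Submodule.range_mkQ,
        Submodule.mkQ_map_self, bot_sup_eq] at this
    obtain ⟨s, hs, hs0⟩ := Submodule.exists_sub_one_mem_and_smul_eq_zero_of_fg_of_le_smul m ⊤
      Module.Finite.fg_top h2
    have hsm : s ∈ m := hle (Module.mem_annihilator.2 fun q => hs0 q trivial)
    refine hm.ne_top ((Ideal.eq_top_iff_one _).2 ?_)
    have := m.sub_mem hsm hs
    simpa using this
  rw [Module.annihilator_eq_top_iff] at hann
  exact Submodule.Quotient.subsingleton_iff.1 hann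

/-! ### Freeness over the tensor square -/

section Final

variable (L P : Type*) [Field L] [AddCommGroup P] [Module L P] [Module Lᵐᵒᵖ P]
  [SMulCommClass L Lᵐᵒᵖ P]

/-- The right action of `L` on `P`, by endomorphisms of the left space `P`. -/
noncomputable def rightMulHom : L →ₐ[bimodCenter L P] Module.End L P where
  toFun b :=
    { toFun := fun p => op b • p
      map_add' := smul_add _
      map_smul' := fun a p => (smul_comm a (op b) p).symm }
  map_one' := LinearMap.ext fun p => by simp
  map_mul' a b := LinearMap.ext fun p => by
    change op (a * b) • p = op a • op b • p
    rw [mul_comm, MulOpposite.op_mul, mul_smul]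
  map_zero' := LinearMap.ext fun p => by simp
  map_add' a b := LinearMap.ext fun p => by simp [add_smul]
  commutes' z := LinearMap.ext fun p => (z.2 p).symm

theorem commute_ofId_rightMulHom (a b : L) :
    Commute (Algebra.ofId L (Module.End L P) a) (rightMulHom L P b) :=
  Algebra.commutes a (rightMulHom L P b)

/-- The two actions of `L`, combined into an action of `L ⊗ L` over the center. -/
noncomputable def tensorActionHom : L ⊗[bimodCenter L P] L →ₐ[L] Module.End L P :=
  Algebra.TensorProduct.lift (Algebra.ofId L (Module.End L P)) (rightMulHom L P)
    (commute_ofId_rightMulHom L P)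

/-- `P` as a module over `L ⊗ L` over the center, with `(a ⊗ b) p = a p b`. -/
noncomputable abbrev tensorModule : Module (L ⊗[bimodCenter L P] L) P :=
  Module.compHom P (tensorActionHom L P).toRingHom

attribute [local instance] tensorModule

variable {L P}

theorem tensorModule_tmul_smul (a b : L) (p : P) : (a ⊗ₜ[bimodCenter L P] b) • p = a • op b • p := by
  change tensorActionHom L P (a ⊗ₜ b) p = _
  rw [tensorActionHom, Algebra.TensorProduct.lift_tmul]
  rfl

instance isScalarTower_tensorModule : IsScalarTower L (L ⊗[bimodCenter L P] L) P where
  smul_assoc a t p := LinearMap.congr_fun (map_smul (tensorActionHom L P) a t) p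

/-- Linear forms on a `κ`-space that is a quotient of `P` pull back to bimodule maps `P → κ`, so the
dimension of such a quotient is at most that of the space of these maps. -/
theorem finrank_dual_quotient_le {κ V : Type*} [Field κ] [AddCommGroup V] [Module κ V]
    (f : L ⊗[bimodCenter L P] L →+* κ) (π : P →+ V) (hπ : Function.Surjective π)
    (hf : ∀ s p, π (s • p) = f s • π p) {d : ℕ} (e : Module.Basis (Fin d) L P) :
    Module.finrank κ V ≤ Module.finrank κ (bimodHoms P
      ((Module.toModuleEnd κ (S := κ) κ).comp
        (f.comp (Algebra.TensorProduct.includeLeft : L →ₐ[bimodCenter L P] _).toRingHom))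
      (f.comp (Algebra.TensorProduct.includeRight : L →ₐ[bimodCenter L P] _).toRingHom)) := by
  set θ := (Module.toModuleEnd κ (S := κ) κ).comp
        (f.comp (Algebra.TensorProduct.includeLeft : L →ₐ[bimodCenter L P] _).toRingHom)
  set τ := f.comp (Algebra.TensorProduct.includeRight : L →ₐ[bimodCenter L P] _).toRingHom
  have := finite_bimodHoms e θ τ
  let T : Module.Dual κ V →ₗ[κ] bimodHoms P θ τ :=
    { toFun := fun φ => ⟨fun p => φ (π p), fun p q => by simp, fun a p => by
        have : a • p = (a ⊗ₜ[bimodCenter L P] (1 : L)) • p := by simp [tensorModule_tmul_smul]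
        beta_reduce
        rw [this, hf, map_smul]
        rfl, fun b p => by
        have : op b • p = ((1 : L) ⊗ₜ[bimodCenter L P] b) • p := by simp [tensorModule_tmul_smul]
        beta_reduce
        rw [this, hf, map_smul]
        rfl⟩
      map_add' := fun _ _ => rfl
      map_smul' := fun _ _ => rfl }
  have hT : Function.Injective T := fun φ ψ h => LinearMap.ext fun v => by
    obtain ⟨p, rfl⟩ := hπ v
    exact congrFun (congrArg Subtype.val h) p
  rw [← Subspace.dual_finrank_eq]
  exact LinearMap.finrank_le_finrank_of_injective hT

/-- If `P / m P` has dimension at most `r` at each maximal ideal `m` and `n * r ≤ d`, then `r` generators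
give a surjection from a free module of left dimension `n * r` onto `P`, of left dimension `d`. -/
theorem exists_linearEquiv_of_finrank_quotient_le {n d r : ℕ}
    [Module.Finite (bimodCenter L P) L] (hn : Module.finrank (bimodCenter L P) L = n)
    (e : Module.Basis (Fin d) L P) (hr : n * r ≤ d)
    (h : ∀ m : MaximalSpectrum (L ⊗[bimodCenter L P] L),
      Module.finrank ((L ⊗[bimodCenter L P] L) ⧸ m.asIdeal)
        (P ⧸ (m.asIdeal • ⊤ : Submodule (L ⊗[bimodCenter L P] L) P)) ≤ r) :
    n * r = d ∧ Nonempty (P ≃ₗ[L ⊗[bimodCenter L P] L] (Fin r → L ⊗[bimodCenter L P] L)) := by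
  have : Module.Finite L P := Module.Finite.of_basis e
  have : Module.Finite (L ⊗[bimodCenter L P] L) P := Module.Finite.of_restrictScalars_finite L _ P
  have : IsArtinianRing (L ⊗[bimodCenter L P] L) := IsArtinianRing.of_finite L _
  obtain ⟨g, hg⟩ := exists_fin_span_eq_top r h
  let G := Fintype.linearCombination (L ⊗[bimodCenter L P] L) g
  have hG : Function.Surjective G := by
    rw [← LinearMap.range_eq_top, Fintype.range_linearCombination, hg]
  have hd : Module.finrank L P = d := by simpa using Module.finrank_eq_card_basis e
  have hS : Module.finrank L (Fin r → L ⊗[bimodCenter L P] L) = n * r := by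
    rw [Module.finrank_pi_fintype, ← hn]
    simp [mul_comm]
  have hle := LinearMap.finrank_le_finrank_of_surjective (f := G.restrictScalars L) hG
  have heq : n * r = d := by omega
  refine ⟨heq, ⟨(LinearEquiv.ofBijective G ⟨?_, hG⟩).symm⟩⟩
  exact (LinearMap.injective_iff_surjective_of_finrank_eq_finrank (f := G.restrictScalars L)
    (by omega)).2 hG

theorem nonempty_bimodEquiv_selfTensor {r : ℕ}
    (E : P ≃ₗ[L ⊗[bimodCenter L P] L] (Fin r → L ⊗[bimodCenter L P] L)) :
    Nonempty (BimodEquiv L P (Fin r → SelfTensor (bimodCenter L P))) := by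
  refine ⟨⟨E.toAddEquiv, fun a p => ?_, fun b p => ?_⟩⟩
  · have : a • p = (a ⊗ₜ[bimodCenter L P] (1 : L)) • p := by simp [tensorModule_tmul_smul]
    rw [this]
    exact E.map_smul _ _
  · have : op b • p = ((1 : L) ⊗ₜ[bimodCenter L P] b) • p := by simp [tensorModule_tmul_smul]
    rw [this]
    exact E.map_smul _ _

end Final

theorem exists_right_generators {L P : Type*} [Field L] [AddCommGroup P] [Module Lᵐᵒᵖ P] {d : ℕ}
    (E : P ≃ₗ[Lᵐᵒᵖ] (Fin d → L)) :
    ∃ e' : Fin d → P, ∀ p, ∃ c : Fin d → L, p = ∑ i, op (c i) • e' i := by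
  refine ⟨fun i => E.symm (Pi.single i 1), fun p => ⟨E p, ?_⟩⟩
  simp only [← map_smul, ← map_sum]
  rw [LinearEquiv.eq_symm_apply]
  funext j
  simp [Finset.sum_apply, Pi.single_apply]

theorem mainTheorem3 {L P : Type*} [Field L] [AddCommGroup P] [Module L P] [Module Lᵐᵒᵖ P]
    [SMulCommClass L Lᵐᵒᵖ P] (d : ℕ) (hP : IsGaloisBimodule L P d) :
    (∃ r : ℕ, Nonempty (BimodEquiv L P (Fin r → SelfTensor (bimodCenter L P)))) ∧
      Module.Finite (bimodCenter L P) L ∧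
      Module.finrank (bimodCenter L P) L ∣ d := by
  obtain ⟨hd, ⟨e₀⟩, ⟨E⟩, ⟨Φ⟩⟩ := hP
  let e := Module.Basis.ofEquivFun e₀
  obtain ⟨n, x, hx⟩ := exists_basis_coord_mem (coeffSpan e)
    (fun f hf => coeffSpan_map_add e hf) (fun f hf => coeffSpan_comp_mul e hf)
    (fun f hf g hg => comp_mem_coeffSpan e Φ hf hg) (coeffSpan_ne_bot e hd) (bimodCenter L P)
    (mem_bimodCenter_iff e)
  have hfin : Module.Finite (bimodCenter L P) L := Module.Finite.of_basis x
  have hn : Module.finrank (bimodCenter L P) L = n := by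
    simpa using Module.finrank_eq_card_basis x
  have hn0 : 0 < n := hn ▸ Module.finrank_pos
  obtain ⟨e', he'⟩ := exists_right_generators E
  have hlin : ∀ (z : bimodCenter L P) (b : L) (i j),
      rightCoeff e (z * b) i j = z * rightCoeff e b i j := fun z b i j =>
    (mem_bimodCenter_iff e z).1 z.2 _ (rightCoeff_mem e i j) b
  let _ : Module (L ⊗[bimodCenter L P] L) P := tensorModule L P
  obtain ⟨heq, ⟨E'⟩⟩ := exists_linearEquiv_of_finrank_quotient_le hn e (r := d / n)
    (Nat.mul_div_le d n) fun m => by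
      let _ : Field ((L ⊗[bimodCenter L P] L) ⧸ m.asIdeal) := Ideal.Quotient.field m.asIdeal
      refine (finrank_dual_quotient_le (Ideal.Quotient.mk m.asIdeal)
        (Submodule.mkQ (m.asIdeal • ⊤ : Submodule (L ⊗[bimodCenter L P] L) P)).toAddMonoidHom
        (Submodule.mkQ_surjective _) (fun s p => rfl) e).trans ?_
      rw [Nat.le_div_iff_mul_le hn0, mul_comm]
      refine (mul_finrank_bimodHoms_le e x hd Φ e' he' hlin hx _ _).trans ?_
      rw [Module.finrank_self, mul_one]
  exact ⟨⟨d / n, nonempty_bimodEquiv_selfTensor E'⟩, hfin, hn ▸ ⟨d / n, heq.symm⟩⟩
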